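/- **Setting.** Let $\Sigma=\langle S,F,R\rangle$ be a many-sorted first-order signature with denumerably many variables of each sort. Formulae are built from $\top,\bot$, atoms $r(t_1,\dots,t_n)$, $\wedge,\vee,\supset$, $\forall x{:}s$, $\exists x{:}s$; they are identified with $\lambda$-types ($\bot,\top,\wedge,\vee,\supset$ being $0,1,\times,+,\to$). $A[t/x]$ is capture-avoiding substitution and $\mathrm{FV}(A)$ the finite set of free variables of $A$. Let $\mathcal E$ be an elementary topos (finite limits and colimits, exponentials, subobject classifier $\top:1\to\Omega$). An *$\mathcal E$-model* $\mathcal U$ of $\Sigma$ consists of an object $Ms$ with $\mathrm{Hom}(1,Ms)\neq\emptyset$ for each sort $s$, an arrow $Ms_1\times\dots\times Ms_n\to Ms_0$ for each function symbol $f:s_1\times\dots\times s_n\to s_0$, and an arrow $Ms_1\times\dots\times Ms_n\to\Omega$ for each relation symbol $r:s_1\times\dots\times s_n$. For a context $X$ (a finite set of variables) let $M(X)$ be the product of the objects $Ms$ over the variables $x{:}s$ in $X$, and let $\top_{a}$ be $a\to1\xrightarrow{\top}\Omega$. A formula $\varphi$ with $\mathrm{FV}(\varphi)\subseteq X$ is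 interpreted as an arrow $[\![X.\varphi]\!]:M(X)\to\Omega$ in the usual way: - terms are interpreted by projections and composition, and an atom by composing with the arrow of its relation symbol; - $\top,\bot,\wedge,\vee,\supset$ are interpreted by composing with the arrows $\top:1\to\Omega$, $\bot:1\to\Omega$ (the character of $0\to1$), $\cap$ (the character of $(\top,\top):1\to\Omega^2$), $\cup$ (the character of the image of $[(\top_\Omega,1),(1,\top_\Omega)]:\Omega+\Omega\to\Omega^2$) and $\Rightarrow$ (the character of the equaliser of $\cap$ and $\pi_1$); - $\forall y{:}s$ and $\exists y{:}s$ are interpreted by composing the exponential transpose $M(X)\to\Omega^{Ms}$ of $[\![X,y.\psi]\!]$ with $\forall_{Ms},\exists_{Ms}:\Omega^{Ms}\to\Omega$, where $\forall_a$ is the character of the transpose $1\to\Omega^a$ of $1\times a\to a\xrightarrow{\top_a}\Omega$ and $\exists_a$ is the character of the image of $\in_a\rightarrowtail\Omega^a\times a\to\Omega^a$, with $\in_a$ the subobject whose character is evaluation. $\mathcal U$ *validates* $\varphi$ ($\mathcal U\models\varphi$) if $[\![\mathrm{FV}(\varphi).\varphi]\!]=\top_{M(\mathrm{FV}(\varphi))}$;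 a sequent $\varphi\vdash_X\psi$ (with $\mathrm{FV}(\varphi)\cup\mathrm{FV}(\psi)\subseteq X$) is *valid in $\mathcal U$* if $[\![X.\varphi\supset\psi]\!]=\top_{M(X)}$. $\mathrm{LD}(\mathcal U)=\langle\mathbb D,N\rangle$: the objects of $\mathbb D$ are the interpretations $N\varphi=[\![\mathrm{FV}(\varphi).\varphi]\!]$ of formulae $\varphi$, each regarded as an arrow to $\Omega$ together with its context $\mathrm{FV}(\varphi)$. There is at most one arrow $a\to b$ in $\mathbb D$. For objects $a:M(X)\to\Omega$ and $b:M(Y)\to\Omega$ with contexts $X$ and $Y$ there is one precisely when ${\Rightarrow}\circ(a\circ\pi_X,\,b\circ\pi_Y)=\top_{M(X\cup Y)}$, where $\pi_X,\pi_Y$ are the projections from $M(X\cup Y)$. A category $\mathbb C$ with a map $M$ from formulae ($\lambda$-types) to objects of $\mathbb C$ is *logically distributive* if: 1. $\mathbb C$ has finite products, finite coproducts and exponentials, and every canonical arrow $(A\times B)+(A\times C)\to A\times(B+C)$ is invertible. 2. For $x{:}s$ and $A$, let $\mathbb C_{\forall x:s.A}$ be the category whose objects are the cones on $(M(A[t/x]))_{t:s}$,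 indexed by all terms $t$ of sort $s$, with vertex of the form $MB$ for some $B$ with $x\notin\mathrm{FV}(B)$, and whose arrows are the identities and the arrows of cones whose codomain has vertex $M(\forall x{:}s.A)$. Dually, let $\mathbb C_{\exists x:s.A}$ be the category of cocones on the same family with vertex of that form, whose arrows are the identities and the arrows of cocones whose domain has vertex $M(\exists x{:}s.A)$. Every $\mathbb C_{\forall x:s.A}$ has a terminal object and every $\mathbb C_{\exists x:s.A}$ has an initial object. 3. $M$ sends $\bot,\top$ to an initial and a terminal object, $A\wedge B$, $A\vee B$, $A\supset B$ to a product $MA\times MB$, a coproduct $MA+MB$ and an exponential $MB^{MA}$, and $M(\forall x{:}s.A)$, $M(\exists x{:}s.A)$ are the vertices of a terminal object of $\mathbb C_{\forall x:s.A}$ and an initial object of $\mathbb C_{\exists x:s.A}$. 4. If $x\notin\mathrm{FV}(A)$ and $\{\delta_t\}$ are the legs of the initial cocone with vertex $M(\exists x{:}s.B)$, the unique arrow $M(\exists x{:}s.A\wedge B)\to MA\times M(\exists x{:}s.B)$ in $\mathbb C_{\exists x:s.A\wedge B}$ to the cocone $\{1_{MA}\times\delta_t\}$ is invertible in $\mathbb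 C$. A sequent $\varphi\vdash_X\psi$ is *valid in* $\langle\mathbb C,M\rangle$ if there is an arrow $M\varphi\to M\psi$ in $\mathbb C$. **Proposition.** For every $\mathcal E$-model $\mathcal U$ of $\Sigma$ in an elementary topos $\mathcal E$: - $\mathrm{LD}(\mathcal U)=\langle\mathbb D,N\rangle$ is a logically distributive category, all of its objects are of the form $N\varphi$, there is at most one arrow between any two objects, and there is an arrow $N\varphi\to N\psi$ if and only if $\mathcal U\models\varphi\supset\psi$; - for every context $X$ and formulae $\varphi,\psi$ with free variables in $X$, the sequent $\varphi\vdash_X\psi$ is valid in $\mathcal U$ if and only if it is valid in $\mathrm{LD}(\mathcal U)$. -/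

import Mathlib

open CategoryTheory CategoryTheory.Limits CategoryTheory.MonoidalCategory
open CategoryTheory.CartesianMonoidalCategory

set_option linter.unusedSectionVars false
set_option linter.checkUnivs false

universe u₁ u₂ u₃ v u

namespace ToposLD

noncomputable section

/-! ## Many-sorted first-order language -/

/-- A logical signature: sorts, function symbols `f : s₁ × ⋯ × sₙ → s₀` and relation symbols
`r : s₁ × ⋯ × sₙ` (with `n = 0` allowed). -/
structure Signature where
  Srt : Type u₁
  Fn : Type u₂
  Rel : Type u₃
  dom : Fn → List Srt
  cod : Fn → Srt
  rdom : Rel → List Srt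

/-- Variables: denumerably many of each sort. -/
structure Var (S : Signature.{u₁, u₂, u₃}) where
  srt : S.Srt
  idx : ℕ

instance (S : Signature.{u₁, u₂, u₃}) : DecidableEq (Var S) := Classical.decEq _

/-- Logical terms, indexed by their sort. -/
inductive Term (S : Signature.{u₁, u₂, u₃}) : S.Srt → Type (max u₁ u₂)
  | var (x : Var S) : Term S x.srt
  | app (f : S.Fn) (ts : ∀ i : Fin (S.dom f).length, Term S ((S.dom f).get i)) : Term S (S.cod f)

/-- Logical formulae. They are identified with the `λ`-types of the signature by the
Curry-Howard correspondence `⊥ ~ 0`, `⊤ ~ 1`, `∧ ~ ×`, `∨ ~ +`, `⊃ ~ →`. -/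
inductive Form (S : Signature.{u₁, u₂, u₃}) : Type (max u₁ u₂ u₃)
  | top : Form S
  | bot : Form S
  | rel (r : S.Rel) (ts : ∀ i : Fin (S.rdom r).length, Term S ((S.rdom r).get i)) : Form S
  | and (A B : Form S) : Form S
  | or (A B : Form S) : Form S
  | imp (A B : Form S) : Form S
  | all (x : Var S) (A : Form S) : Form S
  | ex (x : Var S) (A : Form S) : Form S

variable {S : Signature.{u₁, u₂, u₃}}

/-- Free variables of a term. -/
def Term.FV : {s : S.Srt} → Term S s → Finset (Var S)
  | _, .var x => {x}
  | _, .app _ ts => Finset.univ.biUnion fun i => (ts i).FV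

/-- Free variables of a formula. -/
def Form.FV : Form S → Finset (Var S)
  | .top => ∅
  | .bot => ∅
  | .rel _ ts => Finset.univ.biUnion fun i => (ts i).FV
  | .and A B => A.FV ∪ B.FV
  | .or A B => A.FV ∪ B.FV
  | .imp A B => A.FV ∪ B.FV
  | .all x A => A.FV.erase x
  | .ex x A => A.FV.erase x

/-- A substitution assigns to each variable a term of the same sort. -/
abbrev Subst (S : Signature.{u₁, u₂, u₃}) := ∀ x : Var S, Term S x.srt

/-- Substitution on terms. -/
def Term.subst : {s : S.Srt} → Term S s → Subst S → Term S s
  | _, .var x, σ => σ x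
  | _, .app f ts, σ => .app f fun i => (ts i).subst σ

/-- The index of the variable, of the sort of `x`, used in place of the bound variable `x` when the
variables in `avoid` must not be captured: that of `x` itself if `x` is not in `avoid`, and otherwise
one larger than the index of every variable in `avoid`. -/
def Var.rename (x : Var S) (avoid : Finset (Var S)) : ℕ :=
  if x ∈ avoid then avoid.sup Var.idx + 1 else x.idx

/-- The variables that occur free in the terms substituted by `σ` for the elements of `X`. -/
def Subst.vars (σ : Subst S) (X : Finset (Var S)) : Finset (Var S) :=
  X.biUnion fun y => (σ y).FV

/-- Capture-avoiding substitution on formulae: a bound variable is renamed only when it would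
otherwise capture a variable of a substituted term. -/
def Form.subst : Form S → Subst S → Form S
  | .top, _ => .top
  | .bot, _ => .bot
  | .rel r ts, σ => .rel r fun i => (ts i).subst σ
  | .and A B, σ => .and (A.subst σ) (B.subst σ)
  | .or A B, σ => .or (A.subst σ) (B.subst σ)
  | .imp A B, σ => .imp (A.subst σ) (B.subst σ)
  | .all x A, σ =>
      .all ⟨x.srt, x.rename (σ.vars (A.FV.erase x))⟩
        (A.subst (Function.update σ x (Term.var ⟨x.srt, x.rename (σ.vars (A.FV.erase x))⟩)))
  | .ex x A, σ =>
      .ex ⟨x.srt, x.rename (σ.vars (A.FV.erase x))⟩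
        (A.subst (Function.update σ x (Term.var ⟨x.srt, x.rename (σ.vars (A.FV.erase x))⟩)))

/-- `A[t/x]`. -/
def Form.inst (A : Form S) (x : Var S) (t : Term S x.srt) : Form S :=
  A.subst (Function.update Term.var x t)

theorem Term.subst_eq_self {s : S.Srt} (t : Term S s) (σ : Subst S)
    (h : ∀ y ∈ t.FV, σ y = .var y) : t.subst σ = t := by
  induction t with
  | var x => exact h x (by simp [Term.FV])
  | app f ts ih =>
    simp only [Term.subst, Term.app.injEq]
    funext i
    exact ih i fun y hy => h y (by
      simp only [Term.FV, Finset.mem_biUnion, Finset.mem_univ, true_and]; exact ⟨i, hy⟩)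

theorem Var.rename_eq_self {x : Var S} {X : Finset (Var S)} (h : x ∉ X) : x.rename X = x.idx := by
  simp [Var.rename, h]

theorem Subst.notMem_vars {σ : Subst S} {x : Var S} {X : Finset (Var S)} (hx : x ∉ X)
    (h : ∀ y ∈ X, σ y = .var y) : x ∉ σ.vars X := by
  simp only [Subst.vars, Finset.mem_biUnion, not_exists, not_and]
  intro y hy hxy
  rw [h y hy] at hxy
  simp only [Term.FV, Finset.mem_singleton] at hxy
  exact hx (hxy ▸ hy)

theorem Form.subst_eq_self (A : Form S) (σ : Subst S)
    (h : ∀ y ∈ A.FV, σ y = .var y) : A.subst σ = A := by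
  induction A generalizing σ with
  | top => rfl
  | bot => rfl
  | rel r ts =>
    simp only [Form.subst, Form.rel.injEq, heq_eq_eq, true_and]
    funext i
    exact (ts i).subst_eq_self σ fun y hy => h y (by
      simp only [Form.FV, Finset.mem_biUnion, Finset.mem_univ, true_and]; exact ⟨i, hy⟩)
  | and A B hA hB | or A B hA hB | imp A B hA hB =>
    simp only [Form.subst]
    rw [hA σ fun y hy => h y (Finset.mem_union_left _ hy),
      hB σ fun y hy => h y (Finset.mem_union_right _ hy)]
  | all x A hA | ex x A hA =>
    have hx : x ∉ σ.vars (A.FV.erase x) := Subst.notMem_vars (Finset.notMem_erase x _) h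
    simp only [Form.subst]
    rw [Var.rename_eq_self hx, hA]
    intro y hy
    by_cases hyx : y = x
    · subst hyx; simp
    · rw [Function.update_of_ne hyx]
      exact h y (Finset.mem_erase.2 ⟨hyx, hy⟩)

theorem Form.inst_eq_self {A : Form S} {x : Var S} (hx : x ∉ A.FV) (t : Term S x.srt) :
    A.inst x t = A :=
  A.subst_eq_self _ fun y hy => Function.update_of_ne (by rintro rfl; exact hx hy) _ _

/-! ## Logically distributive categories -/

section LogDist

variable {C : Type u} [Category.{v} C]

/-- `ev : E × A ⟶ B` exhibits `E` as the exponential object `B ^ A`. -/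
def IsExponential [HasFiniteProducts C] {A B E : C} (ev : E ⨯ A ⟶ B) : Prop :=
  ∀ ⦃D : C⦄ (f : D ⨯ A ⟶ B), ∃! g : D ⟶ E, prod.map g (𝟙 A) ≫ ev = f

/-- The canonical arrow `(A × B) + (A × C) ⟶ A × (B + C)`. -/
def distribArrow [HasFiniteProducts C] [HasFiniteCoproducts C] (X Y Z : C) :
    (X ⨯ Y) ⨿ (X ⨯ Z) ⟶ X ⨯ (Y ⨿ Z) :=
  coprod.desc (prod.map (𝟙 X) coprod.inl) (prod.map (𝟙 X) coprod.inr)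

/-- The functor `t ↦ M (A[t/x])` on the discrete category of the terms of the sort of `x`. -/
def substFunctor (M : Form S → C) (x : Var S) (A : Form S) : Discrete (Term S x.srt) ⥤ C :=
  Discrete.functor fun t => M (A.inst x t)

/-- The cones on `t ↦ M (A[t/x])` whose vertex is `M B` for some `B` in which `x` is not free. -/
def forallCones (M : Form S → C) (x : Var S) (A : Form S) :
    ObjectProperty (Cone (substFunctor M x A)) :=
  fun c => ∃ B : Form S, x ∉ B.FV ∧ c.pt = M B

/-- The arrows of cones that are identities or have `M (∀ x. A)` as the vertex of the codomain. -/
def forallArrows (M : Form S → C) (x : Var S) (A : Form S) :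
    MorphismProperty (forallCones M x A).FullSubcategory :=
  fun c d f => (∃ h : c = d, f = eqToHom h) ∨ d.obj.pt = M (.all x A)

instance (M : Form S → C) (x : Var S) (A : Form S) : (forallArrows M x A).IsMultiplicative where
  id_mem _ := Or.inl ⟨rfl, rfl⟩
  comp_mem f g hf hg := by
    rcases hg with ⟨h, rfl⟩ | hg
    · subst h; simpa using hf
    · exact Or.inr hg

/-- The category `C_{∀ x. A}`. -/
abbrev ForallCat (M : Form S → C) (x : Var S) (A : Form S) := WideSubcategory (forallArrows M x A)

/-- The object of `C_{∀ x. A}` given by a cone with vertex `M B`. -/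
def ForallCat.mk {M : Form S → C} {x : Var S} {A : Form S} (B : Form S) (hB : x ∉ B.FV)
    (π : ∀ t : Term S x.srt, M B ⟶ M (A.inst x t)) : ForallCat M x A :=
  ⟨⟨⟨M B, Discrete.natTrans fun t => π t.as⟩, B, hB, rfl⟩⟩

/-- The cocones on `t ↦ M (A[t/x])` whose vertex is `M B` for some `B` in which `x` is not free. -/
def existsCocones (M : Form S → C) (x : Var S) (A : Form S) :
    ObjectProperty (Cocone (substFunctor M x A)) :=
  fun c => ∃ B : Form S, x ∉ B.FV ∧ c.pt = M B

/-- The arrows of cocones that are identities or have `M (∃ x. A)` as the vertex of the domain. -/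
def existsArrows (M : Form S → C) (x : Var S) (A : Form S) :
    MorphismProperty (existsCocones M x A).FullSubcategory :=
  fun c d f => (∃ h : c = d, f = eqToHom h) ∨ c.obj.pt = M (.ex x A)

instance (M : Form S → C) (x : Var S) (A : Form S) : (existsArrows M x A).IsMultiplicative where
  id_mem _ := Or.inl ⟨rfl, rfl⟩
  comp_mem f g hf hg := by
    rcases hf with ⟨h, rfl⟩ | hf
    · subst h; simpa using hg
    · exact Or.inr hf

/-- The category `C_{∃ x. A}`. -/
abbrev ExistsCat (M : Form S → C) (x : Var S) (A : Form S) := WideSubcategory (existsArrows M x A)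

/-- The object of `C_{∃ x. A}` given by a cocone with vertex `M B`. -/
def ExistsCat.mk {M : Form S → C} {x : Var S} {A : Form S} (B : Form S) (hB : x ∉ B.FV)
    (ι : ∀ t : Term S x.srt, M (A.inst x t) ⟶ M B) : ExistsCat M x A :=
  ⟨⟨⟨M B, Discrete.natTrans fun t => ι t.as⟩, B, hB, rfl⟩⟩

/-- The arrow of `C` underlying an arrow of `C_{∃ x. A}`. -/
def ExistsCat.arrow {M : Form S → C} {x : Var S} {A : Form S} {c d : ExistsCat M x A}
    (f : c ⟶ d) : c.obj.obj.pt ⟶ d.obj.obj.pt :=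
  f.hom.hom.hom

theorem Form.notMem_FV_all (x : Var S) (A : Form S) : x ∉ (Form.all x A).FV :=
  Finset.notMem_erase x _

theorem Form.notMem_FV_ex (x : Var S) (A : Form S) : x ∉ (Form.ex x A).FV :=
  Finset.notMem_erase x _

theorem Form.notMem_FV_and_ex {x : Var S} {A : Form S} (hA : x ∉ A.FV) (B : Form S) :
    x ∉ (Form.and A (.ex x B)).FV := by
  simp [Form.FV, hA]

/-- The data and conditions making a category `C` with a map `M` from formulae (`λ`-types) to its
objects a logically distributive category. The equations of objects `M (A × B) = M A × M B`, ...
mean that the left-hand side is a product, coproduct, exponential, ... in `C`; the structure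
records the projections that exhibit `M (A × B)` as a product and the universal (co)cones of
quantified formulae. -/
structure LogDistStructure (M : Form S → C) where
  hasFiniteProducts : HasFiniteProducts C
  hasFiniteCoproducts : HasFiniteCoproducts C
  exponentiation : ∀ A B : C, ∃ (E : C) (ev : E ⨯ A ⟶ B), IsExponential ev
  distributive : ∀ X Y Z : C, IsIso (distribArrow X Y Z)
  hasTerminal : ∀ (x : Var S) (A : Form S), HasTerminal (ForallCat M x A)
  hasInitial : ∀ (x : Var S) (A : Form S), HasInitial (ExistsCat M x A)
  /-- `M 0 = 0` -/
  map_bot : Nonempty (IsInitial (M .bot))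
  /-- `M 1 = 1` -/
  map_top : Nonempty (IsTerminal (M .top))
  /-- `M (A × B) = M A × M B` -/
  andFst : ∀ A B : Form S, M (.and A B) ⟶ M A
  andSnd : ∀ A B : Form S, M (.and A B) ⟶ M B
  map_and : ∀ A B : Form S, IsLimit (BinaryFan.mk (andFst A B) (andSnd A B))
  /-- `M (A + B) = M A + M B` -/
  map_or : ∀ A B : Form S, ∃ (i : M A ⟶ M (.or A B)) (j : M B ⟶ M (.or A B)),
    Nonempty (IsColimit (BinaryCofan.mk i j))
  /-- `M (A → B) = M B ^ M A` -/
  map_imp : ∀ A B : Form S, ∃ ev : M (.imp A B) ⨯ M A ⟶ M B, IsExponential ev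
  /-- `M (∀ x. A)` is the terminal object of `C_{∀ x. A}`. -/
  allπ : ∀ (x : Var S) (A : Form S) (t : Term S x.srt), M (.all x A) ⟶ M (A.inst x t)
  map_all : ∀ (x : Var S) (A : Form S),
    IsTerminal (ForallCat.mk (.all x A) (Form.notMem_FV_all x A) (allπ x A))
  /-- `M (∃ x. A)` is the initial object of `C_{∃ x. A}`. -/
  exι : ∀ (x : Var S) (A : Form S) (t : Term S x.srt), M (A.inst x t) ⟶ M (.ex x A)
  map_ex : ∀ (x : Var S) (A : Form S),
    IsInitial (ExistsCat.mk (.ex x A) (Form.notMem_FV_ex x A) (exι x A))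
  /-- When `x` is not free in `A`, so that `A[t/x] = A`, the arrows
  `1 × δ_t : M ((A × B)[t/x]) = M A × M (B[t/x]) ⟶ M A × M (∃ x. B) = M (A × ∃ x. B)`, with `δ_t`
  the arrows of the initial cocone `M (∃ x. B)`, make `M A × M (∃ x. B)` an object of
  `C_{∃ x. A × B}`; the unique arrow to it from the initial object `M (∃ x. A × B)` is an
  isomorphism of `C`. -/
  frobenius : ∀ (x : Var S) (A B : Form S) (hA : x ∉ A.FV),
    IsIso (ExistsCat.arrow ((map_ex x (.and A B)).to
      (ExistsCat.mk (.and A (.ex x B)) (Form.notMem_FV_and_ex hA B) fun t =>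
        (map_and A (.ex x B)).lift (BinaryFan.mk
          (andFst (A.inst x t) (B.inst x t) ≫ eqToHom (congrArg M (Form.inst_eq_self hA t)))
          (andSnd (A.inst x t) (B.inst x t) ≫ exι x B t)))))

/-- `⟨C, M⟩` is a logically distributive category. -/
def IsLogicallyDistributive (M : Form S → C) : Prop :=
  Nonempty (LogDistStructure M)

/-- The sequent `φ ⊢ ψ` is valid in the logically distributive category `⟨C, M⟩`: there is an
arrow `M φ ⟶ M ψ`. -/
def LDSequentValid (M : Form S → C) (φ ψ : Form S) : Prop :=
  Nonempty (M φ ⟶ M ψ)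

end LogDist

/-! ## The truth-arrows of an elementary topos

An elementary topos is a category with finite limits, finite colimits, exponentials and a subobject
classifier. -/

section Topos

variable {E : Type u} [Category.{v} E]

local notation "Ωₑ" => HasSubobjectClassifier.Ω

instance hasImages_of_classifier [HasFiniteLimits E] [HasFiniteColimits E]
    [HasSubobjectClassifier E] : HasImages E where
  has_image {X Y} f := ⟨⟨{
    F := {
      I := equalizer (pushout.inl f f) (pushout.inr f f)
      m := equalizer.ι _ _
      e := equalizer.lift f pushout.condition }
    isImage := {
      lift := fun F' =>
        let r := regularMonoOfMono F'.m
        Fork.IsLimit.lift r.isLimit (equalizer.ι (pushout.inl f f) (pushout.inr f f)) (by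
          have hf : f ≫ r.left = f ≫ r.right := by
            have hw : (F'.e ≫ F'.m) ≫ r.left = (F'.e ≫ F'.m) ≫ r.right := by
              rw [Category.assoc, Category.assoc, r.w]
            rwa [F'.fac] at hw
          rw [← pushout.inl_desc (f := f) (g := f) r.left r.right hf]
          conv_rhs => rw [← pushout.inr_desc (f := f) (g := f) r.left r.right hf]
          rw [← Category.assoc, ← Category.assoc, equalizer.condition])
      lift_fac := fun F' => by
        let r := regularMonoOfMono F'.m
        exact Fork.IsLimit.lift_ι r.isLimit } }⟩⟩

variable [CartesianMonoidalCategory E] [HasFiniteLimits E] [HasFiniteColimits E]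
  [MonoidalClosed E] [HasSubobjectClassifier E]

instance mono_from_unit {X : E} (f : 𝟙_ E ⟶ X) : Mono f :=
  isTerminalTensorUnit.mono_from f

variable (E) in
/-- The truth arrow `⊤ : 1 ⟶ Ω`. -/
def trueArrow : 𝟙_ E ⟶ Ωₑ E :=
  Subobject.Classifier.χ₀ _ (𝟙_ E) ≫ HasSubobjectClassifier.truth E

/-- `⊤_a : a ⟶ Ω`. -/
def topAt (a : E) : a ⟶ Ωₑ E := toUnit a ≫ trueArrow E

variable (E) in
/-- `⊥ : 1 ⟶ Ω`, the character of `0 ⟶ 1`. -/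
def falseArrow : 𝟙_ E ⟶ Ωₑ E := HasSubobjectClassifier.χ (initial.to (𝟙_ E))

/-- `⊥_a : a ⟶ Ω`. -/
def botAt (a : E) : a ⟶ Ωₑ E := toUnit a ≫ falseArrow E

variable (E) in
/-- Conjunction, the character of `(⊤, ⊤)`. -/
def andArrow : Ωₑ E ⊗ Ωₑ E ⟶ Ωₑ E :=
  HasSubobjectClassifier.χ (lift (trueArrow E) (trueArrow E))

variable (E) in
/-- Disjunction, the character of the image of `[(⊤_Ω, 1), (1, ⊤_Ω)]`. -/
def orArrow : Ωₑ E ⊗ Ωₑ E ⟶ Ωₑ E :=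
  HasSubobjectClassifier.χ (image.ι (coprod.desc
    (lift (topAt (Ωₑ E)) (𝟙 (Ωₑ E))) (lift (𝟙 (Ωₑ E)) (topAt (Ωₑ E)))))

variable (E) in
/-- Implication, the character of the equaliser of conjunction and the first projection. -/
def impArrow : Ωₑ E ⊗ Ωₑ E ⟶ Ωₑ E :=
  HasSubobjectClassifier.χ (equalizer.ι (andArrow E) (fst (Ωₑ E) (Ωₑ E)))

/-- `∀_a : Ω ^ a ⟶ Ω`, the character of the exponential transpose `1 ⟶ Ω ^ a` of
`a × 1 ⟶ a ⟶ Ω`. -/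
def forallArrow (a : E) : (ihom a).obj (Ωₑ E) ⟶ Ωₑ E :=
  HasSubobjectClassifier.χ (MonoidalClosed.curry (fst a (𝟙_ E) ≫ topAt a))

/-- The subobject `∈_a` of `a × Ω ^ a` whose character is the evaluation. -/
def memArrow (a : E) : pullback ((ihom.ev a).app (Ωₑ E)) (HasSubobjectClassifier.truth E) ⟶
    a ⊗ (ihom a).obj (Ωₑ E) :=
  pullback.fst _ _

/-- `∃_a : Ω ^ a ⟶ Ω`, the character of the image of `∈_a ⟶ a × Ω ^ a ⟶ Ω ^ a`. -/
def existsArrow (a : E) : (ihom a).obj (Ωₑ E) ⟶ Ωₑ E :=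
  HasSubobjectClassifier.χ (image.ι (memArrow a ≫ snd a ((ihom a).obj (Ωₑ E))))

theorem topAt_eq (a : E) :
    topAt a = Subobject.Classifier.χ₀ _ a ≫ HasSubobjectClassifier.truth E := by
  rw [topAt, trueArrow, ← Category.assoc]
  congr 1
  exact Subobject.Classifier.isTerminalΩ₀.hom_ext _ _

theorem comp_char_eq_top {U X Z : E} (m : U ⟶ X) [Mono m] (h : Z ⟶ X) :
    h ≫ HasSubobjectClassifier.χ m = topAt Z ↔ ∃ k : Z ⟶ U, k ≫ m = h := by
  have hp := HasSubobjectClassifier.isPullback_χ m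
  constructor
  · intro e
    rw [topAt_eq] at e
    exact ⟨hp.lift h _ e, hp.lift_fst h _ e⟩
  · rintro ⟨k, rfl⟩
    rw [Category.assoc, HasSubobjectClassifier.comm, topAt_eq, ← Category.assoc]
    congr 1
    exact Subobject.Classifier.isTerminalΩ₀.hom_ext _ _

theorem lift_andArrow_eq_top {X : E} (f g : X ⟶ Ωₑ E) :
    lift f g ≫ andArrow E = topAt X ↔ f = topAt X ∧ g = topAt X := by
  rw [andArrow, comp_char_eq_top]
  constructor
  · rintro ⟨k, hk⟩
    have h1 := congrArg (· ≫ fst _ _) hk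
    have h2 := congrArg (· ≫ snd _ _) hk
    simp only [Category.assoc, lift_fst, lift_snd] at h1 h2
    rw [← h1, ← h2, toUnit_unique k (toUnit X)]
    exact ⟨rfl, rfl⟩
  · rintro ⟨rfl, rfl⟩
    exact ⟨toUnit X, by rw [comp_lift]; rfl⟩

theorem truth_ext {X : E} {f g : X ⟶ Ωₑ E}
    (h : ∀ ⦃Z : E⦄ (k : Z ⟶ X), k ≫ f = topAt Z ↔ k ≫ g = topAt Z) : f = g := by
  have key : ∀ g' : X ⟶ Ωₑ E, (∀ ⦃Z : E⦄ (k : Z ⟶ X), k ≫ f = topAt Z ↔ k ≫ g' = topAt Z) →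
      g' = HasSubobjectClassifier.χ (pullback.fst f (HasSubobjectClassifier.truth E)) := by
    intro g' hg'
    refine HasSubobjectClassifier.unique _ _ ⟨⟨?_⟩, ⟨PullbackCone.IsLimit.mk _
      (fun s => pullback.lift s.fst (Subobject.Classifier.χ₀ _ s.pt) ?_) ?_ ?_ ?_⟩⟩
    · rw [← topAt_eq, ← hg', topAt_eq, pullback.condition]
      congr 1
      exact Subobject.Classifier.isTerminalΩ₀.hom_ext _ _
    · rw [← topAt_eq, hg', s.condition, topAt_eq]
      congr 1
      exact Subobject.Classifier.isTerminalΩ₀.hom_ext _ _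
    · intro s; exact pullback.lift_fst _ _ _
    · intro s; exact Subobject.Classifier.isTerminalΩ₀.hom_ext _ _
    · intro s m h1 _
      rw [← cancel_mono (pullback.fst f (HasSubobjectClassifier.truth E)), h1]
      exact (pullback.lift_fst _ _ _).symm
  rw [key f fun _ _ => Iff.rfl, key g h]

/-- `f ⇒ g` is true iff `g` is true at every generalized element at which `f` is true. -/
theorem lift_impArrow_eq_top {X : E} (f g : X ⟶ Ωₑ E) :
    lift f g ≫ impArrow E = topAt X ↔
      ∀ ⦃Z : E⦄ (k : Z ⟶ X), k ≫ f = topAt Z → k ≫ g = topAt Z := by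
  have h1 : lift f g ≫ impArrow E = topAt X ↔ lift f g ≫ andArrow E = f := by
    rw [impArrow, comp_char_eq_top]
    constructor
    · rintro ⟨k, hk⟩
      conv_rhs => rw [← lift_fst f g]
      rw [← hk, Category.assoc, Category.assoc, equalizer.condition]
    · intro h
      exact ⟨equalizer.lift _ (by rw [h, lift_fst]), equalizer.lift_ι _ _⟩
  rw [h1]
  constructor
  · intro h Z k hk
    rw [← h, ← Category.assoc, comp_lift, lift_andArrow_eq_top] at hk
    exact hk.2
  · intro h
    refine truth_ext fun Z k => ?_
    rw [← Category.assoc, comp_lift, lift_andArrow_eq_top]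
    exact ⟨fun e => e.1, fun e => ⟨e, h k e⟩⟩

/-! ## Models in a topos -/

variable (S E) in
/-- An `E`-model on the signature `S`. -/
structure Model where
  obj : S.Srt → E
  inhabited : ∀ s, Nonempty (𝟙_ E ⟶ obj s)
  fn : ∀ f : S.Fn, (∏ᶜ fun i : Fin (S.dom f).length => obj ((S.dom f).get i)) ⟶ obj (S.cod f)
  rel : ∀ r : S.Rel, (∏ᶜ fun i : Fin (S.rdom r).length => obj ((S.rdom r).get i)) ⟶ Ωₑ E

namespace Model

variable (U : Model S E)

/-- The product of the sorts of the variables in a context, contexts being finite sets of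
variables. -/
abbrev ctx (X : Finset (Var S)) : E := ∏ᶜ fun x : {x // x ∈ X} => U.obj x.1.srt

/-- The projection from a context to a smaller one. -/
def proj {X Y : Finset (Var S)} (h : X ⊆ Y) : U.ctx Y ⟶ U.ctx X :=
  Pi.lift fun x => Pi.π (fun y : {y // y ∈ Y} => U.obj y.1.srt) ⟨x.1, h x.2⟩

/-- The arrow from the product of the sort of `y` and the context `X` to the context `X, y`. When
`y` is not in `X` it is the canonical isomorphism; when it is, the new value of `y` replaces the old
one, in accordance with the scoping of a bound variable. -/
def extend (X : Finset (Var S)) (y : Var S) : U.obj y.srt ⊗ U.ctx X ⟶ U.ctx (insert y X) :=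
  Pi.lift fun x =>
    if h : x.1 = y then fst _ _ ≫ eqToHom (by rw [h])
    else snd _ _ ≫ Pi.π (fun z : {z // z ∈ X} => U.obj z.1.srt)
      ⟨x.1, (Finset.mem_insert.1 x.2).resolve_left h⟩

/-- The interpretation of a term in a context containing its free variables. -/
def term (U : Model S E) (X : Finset (Var S)) : {s : S.Srt} → (t : Term S s) → t.FV ⊆ X → (U.ctx X ⟶ U.obj s)
  | _, .var x, h => Pi.π (fun y : {y // y ∈ X} => U.obj y.1.srt) ⟨x, h (Finset.mem_singleton_self x)⟩
  | _, .app f ts, h => Pi.lift (fun i => term U X (ts i)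
      (fun _ hy => h (Finset.mem_biUnion.2 ⟨i, Finset.mem_univ i, hy⟩))) ≫ U.fn f

/-- The interpretation of a formula in a context containing its free variables. -/
def form (U : Model S E) : (φ : Form S) → (X : Finset (Var S)) → φ.FV ⊆ X → (U.ctx X ⟶ Ωₑ E)
  | .top, X, _ => topAt (U.ctx X)
  | .bot, X, _ => botAt (U.ctx X)
  | .rel r ts, X, h => Pi.lift (fun i => term U X (ts i)
      (fun _ hy => h (Finset.mem_biUnion.2 ⟨i, Finset.mem_univ i, hy⟩))) ≫ U.rel r
  | .and A B, X, h => lift (form U A X (Finset.union_subset_left h))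
      (form U B X (Finset.union_subset_right h)) ≫ andArrow E
  | .or A B, X, h => lift (form U A X (Finset.union_subset_left h))
      (form U B X (Finset.union_subset_right h)) ≫ orArrow E
  | .imp A B, X, h => lift (form U A X (Finset.union_subset_left h))
      (form U B X (Finset.union_subset_right h)) ≫ impArrow E
  | .all y A, X, h => MonoidalClosed.curry
      (U.extend X y ≫ form U A (insert y X) (Finset.subset_insert_iff.2 h)) ≫
        forallArrow (U.obj y.srt)
  | .ex y A, X, h => MonoidalClosed.curry
      (U.extend X y ≫ form U A (insert y X) (Finset.subset_insert_iff.2 h)) ≫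
        existsArrow (U.obj y.srt)

/-- `U` validates the formula `φ`. -/
def Validates (φ : Form S) : Prop :=
  U.form φ φ.FV (Finset.Subset.refl _) = topAt (U.ctx φ.FV)

/-- The sequent `φ ⊢_X ψ`, where `X` contains the free variables of `φ` and `ψ`, is valid in `U`. -/
def SequentValid (X : Finset (Var S)) (φ ψ : Form S) (hφ : φ.FV ⊆ X) (hψ : ψ.FV ⊆ X) : Prop :=
  U.form (.imp φ ψ) X (Finset.union_subset hφ hψ) = topAt (U.ctx X)

/-- An arrow section of the projection between contexts; it exists because each sort has a global
element. -/
theorem exists_section {X Y : Finset (Var S)} (h : X ⊆ Y) :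
    ∃ s : U.ctx X ⟶ U.ctx Y, s ≫ U.proj h = 𝟙 _ := by
  refine ⟨Pi.lift fun y => if hy : y.1 ∈ X then
    Pi.π (fun x : {x // x ∈ X} => U.obj x.1.srt) ⟨y.1, hy⟩
    else toUnit _ ≫ (U.inhabited y.1.srt).some, ?_⟩
  refine Pi.hom_ext _ _ fun x => ?_
  simp [proj, x.2]

theorem proj_comp {X Y Z : Finset (Var S)} (h : X ⊆ Y) (h' : Y ⊆ Z) :
    U.proj h' ≫ U.proj h = U.proj (h.trans h') := by
  refine Pi.hom_ext _ _ fun x => ?_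
  simp [proj]

/-- The objects of `LD(U)`: the interpretations `⟦FV(φ). φ⟧` of the formulae `φ`, each one being an
arrow to `Ω` together with its context. -/
structure LDObj where
  context : Finset (Var S)
  arrow : U.ctx context ⟶ Ωₑ E
  exists_form : ∃ (φ : Form S) (h : φ.FV = context), arrow = U.form φ context h.subset

/-- `LD(U)` has at most one arrow from an object to another, and there is one precisely when the
implication between the two objects, in the union of their contexts, is true. -/
instance : LE U.LDObj where
  le a b := lift (U.proj (Finset.subset_union_left (s₂ := b.context)) ≫ a.arrow)
    (U.proj (Finset.subset_union_right (s₁ := a.context)) ≫ b.arrow) ≫ impArrow E =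
      topAt (U.ctx (a.context ∪ b.context))

theorem LDObj.le_iff {a b : U.LDObj} {X : Finset (Var S)} (ha : a.context ⊆ X)
    (hb : b.context ⊆ X) : a ≤ b ↔
      ∀ ⦃Z : E⦄ (k : Z ⟶ U.ctx X), k ≫ U.proj ha ≫ a.arrow = topAt Z →
        k ≫ U.proj hb ≫ b.arrow = topAt Z := by
  refine (lift_impArrow_eq_top _ _).trans ⟨fun h Z k hk => ?_, fun h Z k hk => ?_⟩
  · have := h (k ≫ U.proj (Finset.union_subset ha hb))
    simp only [Category.assoc, reassoc_of% U.proj_comp] at this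
    exact this hk
  · obtain ⟨s, hs⟩ := U.exists_section (Finset.union_subset ha hb)
    have hsa : s ≫ U.proj ha = U.proj Finset.subset_union_left := by
      rw [← U.proj_comp (Finset.subset_union_left) (Finset.union_subset ha hb),
        ← Category.assoc, hs, Category.id_comp]
    have hsb : s ≫ U.proj hb = U.proj Finset.subset_union_right := by
      rw [← U.proj_comp (Finset.subset_union_right) (Finset.union_subset ha hb),
        ← Category.assoc, hs, Category.id_comp]
    have := h (k ≫ s)
    simp only [Category.assoc, reassoc_of% hsa, reassoc_of% hsb] at this
    exact this hk

/-- Identities and composition of `LD(U)`. As a preorder, `LD(U)` is a category. -/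
instance : Preorder U.LDObj where
  le_refl a := (LDObj.le_iff U (Finset.Subset.refl _) (Finset.Subset.refl _)).2 fun _ _ h => h
  le_trans a b c hab hbc := by
    have ha : a.context ⊆ a.context ∪ b.context ∪ c.context := by grind
    have hb : b.context ⊆ a.context ∪ b.context ∪ c.context := by grind
    have hc : c.context ⊆ a.context ∪ b.context ∪ c.context := by grind
    rw [LDObj.le_iff U ha hb] at hab
    rw [LDObj.le_iff U hb hc] at hbc
    rw [LDObj.le_iff U ha hc]
    exact fun Z k hk => hbc k (hab k hk)

/-- The map `N` of `LD(U)`, sending a formula `φ` to `⟦FV(φ). φ⟧`. -/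
def LDMap (φ : Form S) : U.LDObj :=
  ⟨φ.FV, U.form φ φ.FV (Finset.Subset.refl _), φ, rfl, rfl⟩

end Model

end Topos

end

end ToposLD

open ToposLD

/-! ### Truth of the logical arrows at generalized elements -/

namespace ToposLD

noncomputable section

section Truth

variable {E : Type u} [Category.{v} E] [CartesianMonoidalCategory E] [HasFiniteLimits E]
  [HasFiniteColimits E] [MonoidalClosed E] [HasSubobjectClassifier E]

local notation "Ωₑ" => HasSubobjectClassifier.Ω

/-! The proof is Kripke–Joyal semantics. A valuation at a stage `Z` gives every variable a
generalized element `Z ⟶ Ms`, and a formula is forced when its value is `⊤_Z`. Since every sort has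
a global element, each generalized element of a context extends to a valuation of all variables.
Hence the order on `LD(U)` and the validity of a sequent over any context `X` both say the same
thing, that forcing `φ` implies forcing `ψ` at every stage (`LDMap_le_iff`, `sequentValid_iff`), and
contexts drop out.

It remains to see that forcing obeys the rules of intuitionistic logic. The clauses for `⊤`, `∧`,
`⊃` and `∀` are read off from the characters defining these arrows, and `⊥` is handled by strictness
of the initial object. The arrows for `∨` and `∃` are characters of images. Introduction is a
factorisation through the image. For elimination, the image lies in the subobject classified by the
second-order encoding of `∨` or `∃`, by minimality of images; as the encoding quantifies over all
truth values at all later stages, the rule follows without proving that images are stable under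
pullback.

`LD(U)` is thus the preorder of entailment. All equations between arrows are automatic there, so
each universal property reduces to a rule. For `∀x.A`, a cone with vertex `N B` has a leg at the
term `x`, which says that `B` entails `A[x/x] = A`; as `x` is not free in `B`, generalization gives
the arrow to `N (∀x.A)`. The case of `∃` is dual. -/

@[simp]
theorem comp_topAt {X Y : E} (f : X ⟶ Y) : f ≫ topAt Y = topAt X := by
  rw [topAt, topAt, ← Category.assoc, toUnit_unique (f ≫ toUnit Y) (toUnit X)]

/-- The universal quantifier is true iff its argument is true. -/
theorem curry_forallArrow_eq_top {a Z : E} (g : a ⊗ Z ⟶ Ωₑ E) :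
    MonoidalClosed.curry g ≫ forallArrow a = topAt Z ↔ g = topAt (a ⊗ Z) := by
  -- Over any stage, the name of `⊤_a` becomes the transpose of a true arrow.
  have key : ∀ k : Z ⟶ 𝟙_ E,
      k ≫ MonoidalClosed.curry (fst a (𝟙_ E) ≫ topAt a) =
        MonoidalClosed.curry (topAt (a ⊗ Z)) := by
    intro k
    rw [← MonoidalClosed.curry_natural_left, comp_topAt, comp_topAt]
  rw [forallArrow, comp_char_eq_top]
  constructor
  · rintro ⟨k, hk⟩
    rw [key] at hk
    exact (MonoidalClosed.curry_injective hk).symm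
  · rintro rfl
    exact ⟨toUnit Z, key _⟩

/-- The universal quantifier in terms of generalized elements. -/
theorem comp_curry_forallArrow_eq_top {a Y Z : E} (g : a ⊗ Y ⟶ Ωₑ E) (k : Z ⟶ Y) :
    k ≫ MonoidalClosed.curry g ≫ forallArrow a = topAt Z ↔
      ∀ ⦃W : E⦄ (j : W ⟶ Z) (b : W ⟶ a), lift b (j ≫ k) ≫ g = topAt W := by
  rw [← Category.assoc, ← MonoidalClosed.curry_natural_left, curry_forallArrow_eq_top]
  constructor
  · intro h W j b
    have := congrArg (lift b j ≫ ·) h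
    simpa using this
  · intro h
    -- It suffices to test the generic element: the stage `a ⊗ Z` with its two projections.
    have := h (snd a Z) (fst a Z)
    rwa [show lift (fst a Z) (snd a Z ≫ k) = a ◁ k by ext <;> simp] at this

/-- Truth of `⊥` gives an arrow `k : Z ⟶ 0`. Tensoring with `Z` is a left adjoint, so `Z ⊗ 0` is
initial and all arrows out of it agree; `(1, k)` is a section of its projection to `Z`. -/
theorem eq_top_of_comp_botAt {Z : E} (h : botAt Z = topAt Z) (f : Z ⟶ Ωₑ E) : f = topAt Z := by
  rw [botAt, falseArrow, comp_char_eq_top] at h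
  obtain ⟨k, -⟩ := h
  have hi : IsInitial (Z ⊗ (⊥_ E)) :=
    IsInitial.isInitialObj (tensorLeft Z) _ initialIsInitial
  have := congrArg (lift (𝟙 Z) k ≫ ·) (hi.hom_ext (fst _ _ ≫ f) (fst _ _ ≫ topAt Z))
  simpa using this

/-- The image of `f` is contained in every subobject through which `f` factors. -/
theorem comp_char_image_eq_top {A B Z : E} (f : A ⟶ B) {v : B ⟶ Ωₑ E} (hv : f ≫ v = topAt A)
    {k : Z ⟶ B} (hk : k ≫ HasSubobjectClassifier.χ (image.ι f) = topAt Z) :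
    k ≫ v = topAt Z := by
  rw [comp_char_eq_top] at hk
  obtain ⟨l, rfl⟩ := hk
  -- The subobject classified by `v`, through which `f` factors by `hv`; the image is contained in
  -- it.
  let F : MonoFactorisation f :=
    { I := pullback v (HasSubobjectClassifier.truth E)
      m := pullback.fst _ _
      e := pullback.lift f (Subobject.Classifier.χ₀ _ A) (by rw [hv, topAt_eq])
      fac := pullback.lift_fst _ _ _ }
  have hF : F.m ≫ v = topAt F.I := by
    change pullback.fst _ _ ≫ v = _
    rw [topAt_eq, pullback.condition]
    congr 1
    exact Subobject.Classifier.isTerminalΩ₀.hom_ext _ _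
  rw [← image.lift_fac F, Category.assoc, Category.assoc, hF, comp_topAt, comp_topAt]

/-- The pair `(⊤, g)` is `g` followed by `(⊤_Ω, 1)`, the first summand of the arrow whose image
defines disjunction. -/
theorem lift_orArrow_eq_top_left {Z : E} {f g : Z ⟶ Ωₑ E} (hf : f = topAt Z) :
    lift f g ≫ orArrow E = topAt Z := by
  rw [orArrow, comp_char_eq_top]
  refine ⟨g ≫ coprod.inl ≫ factorThruImage _, ?_⟩
  rw [Category.assoc, Category.assoc, image.fac, coprod.inl_desc, comp_lift, comp_topAt,
    Category.comp_id, hf]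

theorem lift_orArrow_eq_top_right {Z : E} {f g : Z ⟶ Ωₑ E} (hg : g = topAt Z) :
    lift f g ≫ orArrow E = topAt Z := by
  rw [orArrow, comp_char_eq_top]
  refine ⟨f ≫ coprod.inr ≫ factorThruImage _, ?_⟩
  rw [Category.assoc, Category.assoc, image.fac, coprod.inr_desc, comp_lift, comp_topAt,
    Category.comp_id, hg]

variable (E) in
/-- The second-order encoding `∀ r. (p ⇒ r) ⇒ ((q ⇒ r) ⇒ r)` of `p ∨ q`. -/
def orEncoding : Ωₑ E ⊗ Ωₑ E ⟶ Ωₑ E :=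
  MonoidalClosed.curry (lift (lift (snd _ _ ≫ fst _ _) (fst (Ωₑ E) (Ωₑ E ⊗ Ωₑ E)) ≫ impArrow E)
    (lift (lift (snd _ _ ≫ snd _ _) (fst _ _) ≫ impArrow E) (fst _ _) ≫ impArrow E) ≫ impArrow E) ≫
      forallArrow (Ωₑ E)

theorem lift_orEncoding_eq_top {Z : E} (f g : Z ⟶ Ωₑ E) :
    lift f g ≫ orEncoding E = topAt Z ↔ ∀ ⦃W : E⦄ (j : W ⟶ Z) (r : W ⟶ Ωₑ E),
      (∀ ⦃V : E⦄ (i : V ⟶ W), i ≫ j ≫ f = topAt V → i ≫ r = topAt V) →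
      (∀ ⦃V : E⦄ (i : V ⟶ W), i ≫ j ≫ g = topAt V → i ≫ r = topAt V) → r = topAt W := by
  rw [orEncoding, comp_curry_forallArrow_eq_top]
  simp only [← Category.assoc, comp_lift, lift_impArrow_eq_top, lift_fst, lift_snd]
  constructor
  · intro h W j r hf hg
    have := h j r (𝟙 W) (fun V i => by simpa using hf i) (𝟙 W) (fun V i => by simpa using hg i)
    simpa using this
  · intro h W j r V i hf V' i' hg
    -- Each nested implication moves to a later stage; the hypothesis is used at the last one, with
    -- the earlier premise restricted to it.
    refine h (i' ≫ i ≫ j) _ (fun V'' i'' h' => ?_) (fun V'' i'' h' => ?_)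
    · simpa using hf (i'' ≫ i') (by simpa using h')
    · simpa using hg i'' (by simpa using h')

/-- Minimality of the image only tests arrows on `Ω ⊗ Ω`, whereas `h` lives on `Z`. The encoding is
an arrow on `Ω ⊗ Ω` that is true on both summands, and it can be instantiated afterwards at `r = h`.
-/
theorem eq_top_of_lift_orArrow {Z : E} {f g h : Z ⟶ Ωₑ E} (hfg : lift f g ≫ orArrow E = topAt Z)
    (hf : ∀ ⦃W : E⦄ (j : W ⟶ Z), j ≫ f = topAt W → j ≫ h = topAt W)
    (hg : ∀ ⦃W : E⦄ (j : W ⟶ Z), j ≫ g = topAt W → j ≫ h = topAt W) : h = topAt Z := by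
  have hv : coprod.desc (lift (topAt (Ωₑ E)) (𝟙 (Ωₑ E))) (lift (𝟙 (Ωₑ E)) (topAt (Ωₑ E))) ≫
      orEncoding E = topAt _ := by
    ext
    · rw [coprod.inl_desc_assoc, comp_topAt, lift_orEncoding_eq_top]
      intro W j r h1 _
      simpa using h1 (𝟙 W) (by simp)
    · rw [coprod.inr_desc_assoc, comp_topAt, lift_orEncoding_eq_top]
      intro W j r _ h1
      simpa using h1 (𝟙 W) (by simp)
  have := (lift_orEncoding_eq_top f g).1 (comp_char_image_eq_top _ hv hfg) (𝟙 Z) h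
  simp only [Category.id_comp] at this
  exact this hf hg

/-- The witness paired with the transpose of `g` evaluates to true, so it factors through `∈_a`, and
its second component through the image. -/
theorem curry_existsArrow_eq_top {a Z : E} {g : a ⊗ Z ⟶ Ωₑ E} (b : Z ⟶ a)
    (h : lift b (𝟙 Z) ≫ g = topAt Z) : MonoidalClosed.curry g ≫ existsArrow a = topAt Z := by
  rw [existsArrow, comp_char_eq_top]
  have hb : lift b (MonoidalClosed.curry g) ≫ (ihom.ev a).app (Ωₑ E) = topAt Z := by
    rw [← h, ← MonoidalClosed.uncurry_id_eq_ev, show lift b (MonoidalClosed.curry g) =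
      lift b (𝟙 Z) ≫ a ◁ MonoidalClosed.curry g by ext <;> simp, Category.assoc,
      ← MonoidalClosed.uncurry_natural_left, Category.comp_id, MonoidalClosed.uncurry_curry]
  rw [topAt_eq] at hb
  refine ⟨pullback.lift _ _ hb ≫ factorThruImage _, ?_⟩
  rw [Category.assoc, image.fac, memArrow, pullback.lift_fst_assoc, lift_snd]

/-- The second-order encoding `∀ p. (∀ x. s x ⇒ p) ⇒ p` of `∃ x. s x`. -/
def existsEncoding (a : E) : (ihom a).obj (Ωₑ E) ⟶ Ωₑ E :=
  MonoidalClosed.curry (lift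
    (MonoidalClosed.curry (lift
      (lift (fst a (Ωₑ E ⊗ (ihom a).obj (Ωₑ E))) (snd _ _ ≫ snd _ _) ≫ (ihom.ev a).app (Ωₑ E))
      (snd _ _ ≫ fst _ _) ≫ impArrow E) ≫ forallArrow a)
    (fst _ _) ≫ impArrow E) ≫ forallArrow (Ωₑ E)

theorem comp_existsEncoding_eq_top {a Z : E} (s : Z ⟶ (ihom a).obj (Ωₑ E)) :
    s ≫ existsEncoding a = topAt Z ↔ ∀ ⦃W : E⦄ (j : W ⟶ Z) (p : W ⟶ Ωₑ E),
      (∀ ⦃V : E⦄ (i : V ⟶ W) (b : V ⟶ a),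
        lift b (i ≫ j ≫ s) ≫ (ihom.ev a).app (Ωₑ E) = topAt V → i ≫ p = topAt V) →
      p = topAt W := by
  rw [existsEncoding, comp_curry_forallArrow_eq_top]
  have key : ∀ ⦃W : E⦄ (j : W ⟶ Z) (p : W ⟶ Ωₑ E) ⦃V : E⦄ (i : V ⟶ W),
      i ≫ lift p (j ≫ s) ≫ (MonoidalClosed.curry (lift
        (lift (fst a (Ωₑ E ⊗ (ihom a).obj (Ωₑ E))) (snd _ _ ≫ snd _ _) ≫ (ihom.ev a).app (Ωₑ E))
        (snd _ _ ≫ fst _ _) ≫ impArrow E) ≫ forallArrow a) = topAt V ↔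
      ∀ ⦃V' : E⦄ (i' : V' ⟶ V) (b : V' ⟶ a) ⦃V'' : E⦄ (i'' : V'' ⟶ V'),
        lift (i'' ≫ b) (i'' ≫ i' ≫ i ≫ j ≫ s) ≫ (ihom.ev a).app (Ωₑ E) = topAt V'' →
          i'' ≫ i' ≫ i ≫ p = topAt V'' := by
    intro W j p V i
    rw [← Category.assoc, comp_curry_forallArrow_eq_top]
    simp only [← Category.assoc, comp_lift, lift_impArrow_eq_top, lift_fst, lift_snd]
  simp only [← Category.assoc (lift _ _) (lift _ _), comp_lift, lift_impArrow_eq_top, lift_fst,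
    key]
  constructor
  · intro h W j p hp
    have := h j p (𝟙 W) (fun V' i' b V'' i'' h' => by
      simpa using hp (i'' ≫ i') (i'' ≫ b) (by simpa using h'))
    simpa using this
  · intro h W j p V i hp
    refine h (i ≫ j) _ fun V' i' b h' => ?_
    simpa using hp i' b (𝟙 V') (by simpa using h')

/-- As for disjunction: the encoding holds on `∈_a`, hence on its image in `Ω ^ a`, and is then
instantiated at `p = h`. -/
theorem eq_top_of_curry_existsArrow {a Z : E} {g : a ⊗ Z ⟶ Ωₑ E} {h : Z ⟶ Ωₑ E}
    (hg : MonoidalClosed.curry g ≫ existsArrow a = topAt Z)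
    (hgh : ∀ ⦃W : E⦄ (j : W ⟶ Z) (b : W ⟶ a), lift b j ≫ g = topAt W → j ≫ h = topAt W) :
    h = topAt Z := by
  have hv : (memArrow a ≫ snd a ((ihom a).obj (Ωₑ E))) ≫ existsEncoding a = topAt _ := by
    rw [comp_existsEncoding_eq_top]
    intro W j p hp
    -- The witness is the element component of the point of `∈_a`.
    have := hp (𝟙 W) (j ≫ memArrow a ≫ fst _ _) (by
      rw [Category.id_comp, ← comp_lift, ← comp_lift, lift_fst_snd, Category.comp_id,
        Category.assoc, memArrow, pullback.condition, ← Category.assoc, topAt_eq]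
      congr 1
      exact Subobject.Classifier.isTerminalΩ₀.hom_ext _ _)
    simpa using this
  have := (comp_existsEncoding_eq_top _).1 (comp_char_image_eq_top _ hv hg) (𝟙 Z) h
  refine this fun W j b hb => hgh j b ?_
  rw [← hb, Category.id_comp, ← MonoidalClosed.uncurry_id_eq_ev,
    show lift b (j ≫ MonoidalClosed.curry g) =
      lift b j ≫ a ◁ MonoidalClosed.curry g by ext <;> simp, Category.assoc,
    ← MonoidalClosed.uncurry_natural_left, Category.comp_id, MonoidalClosed.uncurry_curry]

end Truth

end

end ToposLD

/-! ### Valuations, the substitution lemma and forcing -/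

namespace ToposLD

noncomputable section

theorem Var.rename_notMem {S : Signature.{u₁, u₂, u₃}} (x : Var S) (X : Finset (Var S)) :
    (⟨x.srt, x.rename X⟩ : Var S) ∉ X := by
  by_cases h : x ∈ X
  · intro hx
    have := Finset.le_sup (f := Var.idx) hx
    simp only [Var.rename, if_pos h] at this
    exact absurd this (Nat.not_succ_le_self _)
  · rwa [Var.rename_eq_self h]

theorem Form.inst_var_self {S : Signature.{u₁, u₂, u₃}} (A : Form S) (x : Var S) :
    A.inst x (.var x) = A :=
  A.subst_eq_self _ fun y _ => by rw [Function.update_eq_self]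

namespace Model

variable {S : Signature.{u₁, u₂, u₃}} {E : Type u} [Category.{v} E] [CartesianMonoidalCategory E]
  [HasFiniteLimits E] [HasFiniteColimits E] [MonoidalClosed E] [HasSubobjectClassifier E]

local notation "Ωₑ" => HasSubobjectClassifier.Ω

variable (U : Model S E)

/-- A valuation at stage `Z`: a generalized element of the appropriate sort for each variable. -/
abbrev Valuation (Z : E) := ∀ x : Var S, Z ⟶ U.obj x.srt

variable {U} {Z W : E}

namespace Valuation

/-- Restriction of a valuation along an arrow. -/
def restrict (ρ : U.Valuation Z) (k : W ⟶ Z) : U.Valuation W := fun x => k ≫ ρ x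

/-- The generalized element of a context given by a valuation. -/
def toCtx (ρ : U.Valuation Z) (X : Finset (Var S)) : Z ⟶ U.ctx X := Pi.lift fun x => ρ x.1

/-- The valuation at stage `U.obj y.srt ⊗ Z` with `y` generic. -/
def generic (ρ : U.Valuation Z) (y : Var S) : U.Valuation (U.obj y.srt ⊗ Z) :=
  Function.update (ρ.restrict (snd _ _)) y (fst _ _)

theorem restrict_id (ρ : U.Valuation Z) : ρ.restrict (𝟙 Z) = ρ :=
  funext fun _ => Category.id_comp _

theorem comp_toCtx (ρ : U.Valuation Z) (k : W ⟶ Z) (X : Finset (Var S)) :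
    k ≫ ρ.toCtx X = (ρ.restrict k).toCtx X :=
  Pi.hom_ext _ _ fun x => by simp [toCtx, restrict]

theorem toCtx_proj (ρ : U.Valuation Z) {X Y : Finset (Var S)} (h : X ⊆ Y) :
    ρ.toCtx Y ≫ U.proj h = ρ.toCtx X :=
  Pi.hom_ext _ _ fun x => by simp [toCtx, proj]

/-- The induction step under a binder. It needs no `y ∉ X`, since both sides overwrite an old value
of `y`. -/
theorem whiskerLeft_toCtx_extend (ρ : U.Valuation Z) (X : Finset (Var S)) (y : Var S) :
    U.obj y.srt ◁ ρ.toCtx X ≫ U.extend X y = (ρ.generic y).toCtx (insert y X) := by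
  refine Pi.hom_ext _ _ fun ⟨x, hx⟩ => ?_
  by_cases h : x = y
  · subst h
    simp [toCtx, extend, generic]
  · simp [toCtx, extend, generic, restrict, h]

theorem restrict_lift_generic (ρ : U.Valuation Z) (y : Var S) (j : W ⟶ Z)
    (b : W ⟶ U.obj y.srt) :
    (ρ.generic y).restrict (lift b j) = Function.update (ρ.restrict j) y b := by
  funext x
  by_cases h : x = y
  · subst h
    simp [generic, restrict]
  · simp [generic, restrict, h]

/-- Variables outside `X` take the value of a global element of their sort. -/
theorem exists_toCtx_eq {X : Finset (Var S)} (k : Z ⟶ U.ctx X) :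
    ∃ ρ : U.Valuation Z, ρ.toCtx X = k := by
  refine ⟨fun x => if h : x ∈ X then k ≫ Pi.π (fun y : {y // y ∈ X} => U.obj y.1.srt) ⟨x, h⟩
    else toUnit _ ≫ (U.inhabited x.srt).some, Pi.hom_ext _ _ fun x => ?_⟩
  simp [toCtx]

end Valuation

/-- The value of a term under a valuation. -/
def termValue (ρ : U.Valuation Z) : {s : S.Srt} → Term S s → (Z ⟶ U.obj s)
  | _, .var x => ρ x
  | _, .app f ts => Pi.lift (fun i => termValue ρ (ts i)) ≫ U.fn f

/-- The truth value of a formula under a valuation. -/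
def eval : Form S → {Z : E} → U.Valuation Z → (Z ⟶ Ωₑ E)
  | .top, Z, _ => topAt Z
  | .bot, Z, _ => botAt Z
  | .rel r ts, _, ρ => Pi.lift (fun i => termValue ρ (ts i)) ≫ U.rel r
  | .and A B, _, ρ => lift (eval A ρ) (eval B ρ) ≫ andArrow E
  | .or A B, _, ρ => lift (eval A ρ) (eval B ρ) ≫ orArrow E
  | .imp A B, _, ρ => lift (eval A ρ) (eval B ρ) ≫ impArrow E
  | .all y A, _, ρ => MonoidalClosed.curry (eval A (ρ.generic y)) ≫ forallArrow (U.obj y.srt)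
  | .ex y A, _, ρ => MonoidalClosed.curry (eval A (ρ.generic y)) ≫ existsArrow (U.obj y.srt)

theorem toCtx_term (ρ : U.Valuation Z) (X : Finset (Var S)) {s : S.Srt} (t : Term S s)
    (h : t.FV ⊆ X) : ρ.toCtx X ≫ U.term X t h = termValue ρ t := by
  induction t with
  | var x => simp [term, termValue, Valuation.toCtx]
  | app f ts ih =>
    rw [term, termValue, ← Category.assoc]
    congr 1
    exact Pi.hom_ext _ _ fun i => by simp [ih]

/-- Transposition is natural in the stage, which carries the induction through the quantifiers.
Stability under restriction and dependence on the free variables alone then need no further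
induction. -/
theorem toCtx_form (A : Form S) {Z : E} (ρ : U.Valuation Z) (X : Finset (Var S)) (h : A.FV ⊆ X) :
    ρ.toCtx X ≫ U.form A X h = eval A ρ := by
  induction A generalizing Z X with
  | top => exact comp_topAt _
  | bot =>
    rw [form, eval, botAt, botAt, ← Category.assoc]
    congr 1
    exact toUnit_unique _ _
  | rel r ts =>
    rw [form, eval, ← Category.assoc]
    congr 1
    exact Pi.hom_ext _ _ fun i => by simp [toCtx_term]
  | and A B hA hB | or A B hA hB | imp A B hA hB =>
    rw [form, eval, ← Category.assoc, comp_lift, hA, hB]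
  | all y A hA | ex y A hA =>
    rw [form, eval, ← Category.assoc, ← MonoidalClosed.curry_natural_left, ← Category.assoc,
      Valuation.whiskerLeft_toCtx_extend, hA]

theorem comp_eval (A : Form S) (ρ : U.Valuation Z) (k : W ⟶ Z) :
    k ≫ eval A ρ = eval A (ρ.restrict k) := by
  rw [← toCtx_form A _ _ (Finset.Subset.refl _), ← toCtx_form A _ _ (Finset.Subset.refl _),
    ← Category.assoc, Valuation.comp_toCtx]

theorem termValue_congr {ρ ρ' : U.Valuation Z} {s : S.Srt} (t : Term S s)
    (h : ∀ x ∈ t.FV, ρ x = ρ' x) : termValue ρ t = termValue ρ' t := by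
  rw [← toCtx_term ρ _ _ (Finset.Subset.refl _), ← toCtx_term ρ' _ _ (Finset.Subset.refl _)]
  congr 1
  exact Pi.hom_ext _ _ fun x => by simp [Valuation.toCtx, h x.1 x.2]

theorem eval_congr {ρ ρ' : U.Valuation Z} (A : Form S) (h : ∀ x ∈ A.FV, ρ x = ρ' x) :
    eval A ρ = eval A ρ' := by
  rw [← toCtx_form A ρ _ (Finset.Subset.refl _), ← toCtx_form A ρ' _ (Finset.Subset.refl _)]
  congr 1
  exact Pi.hom_ext _ _ fun x => by simp [Valuation.toCtx, h x.1 x.2]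

theorem comp_termValue (ρ : U.Valuation Z) (k : W ⟶ Z) {s : S.Srt} (t : Term S s) :
    k ≫ termValue ρ t = termValue (ρ.restrict k) t := by
  rw [← toCtx_term _ _ _ (Finset.Subset.refl _), ← toCtx_term _ _ _ (Finset.Subset.refl _),
    ← Category.assoc, Valuation.comp_toCtx]

theorem termValue_subst (ρ : U.Valuation Z) (σ : Subst S) {s : S.Srt} (t : Term S s) :
    termValue ρ (t.subst σ) = termValue (fun x => termValue ρ (σ x)) t := by
  induction t with
  | var x => rfl
  | app f ts ih => simp only [Term.subst, termValue, ih]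

/-- The body of a quantifier in the substitution lemma, with `hA` as induction hypothesis. By `hn`
the new bound variable is in no term substituted for another free variable of `A`, so making it
generic leaves their values unchanged. -/
theorem eval_subst_generic (A : Form S) (ρ : U.Valuation Z) (σ : Subst S) (x : Var S)
    (hA : ∀ {Z : E} (ρ : U.Valuation Z) (σ : Subst S),
      eval (A.subst σ) ρ = eval A fun y => termValue ρ (σ y)) (n : ℕ)
    (hn : (⟨x.srt, n⟩ : Var S) ∉ σ.vars (A.FV.erase x)) :
    eval (A.subst (Function.update σ x (Term.var ⟨x.srt, n⟩))) (ρ.generic ⟨x.srt, n⟩) =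
      eval A (Valuation.generic (fun y => termValue ρ (σ y)) x) := by
  rw [hA]
  refine eval_congr A fun y hy => ?_
  by_cases h : y = x
  · subst h
    simp only [Function.update_self, termValue, Valuation.generic]
  · rw [Function.update_of_ne h, Valuation.generic, Valuation.generic, Function.update_of_ne h,
      Valuation.restrict, comp_termValue]
    refine termValue_congr _ fun z hz => Function.update_of_ne ?_ _ _
    rintro rfl
    exact hn (Finset.mem_biUnion.2 ⟨y, Finset.mem_erase.2 ⟨h, hy⟩, hz⟩)

/-- The substitution lemma. -/
theorem eval_subst (A : Form S) {Z : E} (ρ : U.Valuation Z) (σ : Subst S) :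
    eval (A.subst σ) ρ = eval A fun y => termValue ρ (σ y) := by
  induction A generalizing Z σ with
  | top => rfl
  | bot => rfl
  | rel r ts => simp only [Form.subst, eval, termValue_subst]
  | and A B hA hB | or A B hA hB | imp A B hA hB => simp only [Form.subst, eval, hA, hB]
  | all x A hA | ex x A hA =>
    simp only [Form.subst, eval]
    rw [eval_subst_generic A ρ σ x hA _ (x.rename_notMem _)]

theorem eval_inst (A : Form S) (ρ : U.Valuation Z) (x : Var S) (t : Term S x.srt) :
    eval (A.inst x t) ρ = eval A (Function.update ρ x (termValue ρ t)) := by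
  rw [Form.inst, eval_subst]
  congr 1
  funext y
  by_cases h : y = x
  · subst h; simp
  · simp [h, termValue]

/-- The formula `A` is true under the valuation `ρ`. -/
def Forces (ρ : U.Valuation Z) (A : Form S) : Prop := eval A ρ = topAt Z

namespace Forces

variable {ρ : U.Valuation Z} {A B : Form S}

theorem mono (h : Forces ρ A) (k : W ⟶ Z) : Forces (ρ.restrict k) A := by
  rw [Forces, ← comp_eval, h, comp_topAt]

theorem congr {ρ' : U.Valuation Z} (h : Forces ρ A) (h' : ∀ x ∈ A.FV, ρ x = ρ' x) :
    Forces ρ' A := by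
  rw [Forces, ← eval_congr A h', h]

theorem inst_iff {x : Var S} {t : Term S x.srt} :
    Forces ρ (A.inst x t) ↔ Forces (Function.update ρ x (termValue ρ t)) A := by
  rw [Forces, eval_inst, Forces]

theorem top : Forces ρ .top := rfl

theorem bot_elim (h : Forces ρ .bot) : Forces ρ A := eq_top_of_comp_botAt h _

theorem and_iff : Forces ρ (.and A B) ↔ Forces ρ A ∧ Forces ρ B := lift_andArrow_eq_top _ _

theorem imp_iff : Forces ρ (.imp A B) ↔
    ∀ ⦃W : E⦄ (k : W ⟶ Z), Forces (ρ.restrict k) A → Forces (ρ.restrict k) B := by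
  simp only [Forces, eval, lift_impArrow_eq_top, comp_eval]

theorem or_inl (h : Forces ρ A) : Forces ρ (.or A B) := lift_orArrow_eq_top_left h

theorem or_inr (h : Forces ρ B) : Forces ρ (.or A B) := lift_orArrow_eq_top_right h

theorem or_elim {D : Form S} (h : Forces ρ (.or A B))
    (hA : ∀ ⦃W : E⦄ (k : W ⟶ Z), Forces (ρ.restrict k) A → Forces (ρ.restrict k) D)
    (hB : ∀ ⦃W : E⦄ (k : W ⟶ Z), Forces (ρ.restrict k) B → Forces (ρ.restrict k) D) :
    Forces ρ D := by
  simp only [Forces, ← comp_eval] at hA hB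
  exact eq_top_of_lift_orArrow h hA hB

theorem all_iff {x : Var S} : Forces ρ (.all x A) ↔ ∀ ⦃W : E⦄ (k : W ⟶ Z) (b : W ⟶ U.obj x.srt),
    Forces (Function.update (ρ.restrict k) x b) A := by
  simp only [Forces, ← Valuation.restrict_lift_generic, ← comp_eval]
  rw [eval, ← Category.id_comp (MonoidalClosed.curry _ ≫ _), comp_curry_forallArrow_eq_top]
  simp

theorem ex_intro {x : Var S} (b : Z ⟶ U.obj x.srt) (h : Forces (Function.update ρ x b) A) :
    Forces ρ (.ex x A) := by
  refine curry_existsArrow_eq_top b ?_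
  rw [comp_eval, Valuation.restrict_lift_generic, Valuation.restrict_id]
  exact h

theorem ex_elim {x : Var S} {D : Form S} (h : Forces ρ (.ex x A))
    (hD : ∀ ⦃W : E⦄ (k : W ⟶ Z) (b : W ⟶ U.obj x.srt),
      Forces (Function.update (ρ.restrict k) x b) A → Forces (ρ.restrict k) D) :
    Forces ρ D := by
  simp only [Forces, ← Valuation.restrict_lift_generic, ← comp_eval] at hD
  exact eq_top_of_curry_existsArrow h hD

end Forces

/-! ### Entailment and the rules of intuitionistic logic -/

variable (U) in
/-- Semantic entailment over all valuations. -/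
def Entails (φ ψ : Form S) : Prop :=
  ∀ ⦃Z : E⦄ (ρ : U.Valuation Z), Forces ρ φ → Forces ρ ψ

theorem LDMap_le_iff {φ ψ : Form S} : U.LDMap φ ≤ U.LDMap ψ ↔ U.Entails φ ψ := by
  rw [LDObj.le_iff U (X := φ.FV ∪ ψ.FV) Finset.subset_union_left Finset.subset_union_right]
  have key : ∀ ⦃Z : E⦄ (ρ : U.Valuation Z) (χ : Form S) (h : χ.FV ⊆ φ.FV ∪ ψ.FV),
      ρ.toCtx (φ.FV ∪ ψ.FV) ≫ U.proj h ≫ (U.LDMap χ).arrow = topAt Z ↔ Forces ρ χ := by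
    intro Z ρ χ h
    have e := toCtx_form χ ρ χ.FV (Finset.Subset.refl _)
    rw [← ρ.toCtx_proj h, Category.assoc] at e
    exact e.congr_left
  constructor
  · intro h Z ρ hφ
    exact (key ρ ψ Finset.subset_union_right).1 (h _ ((key ρ φ Finset.subset_union_left).2 hφ))
  · intro h Z k hk
    obtain ⟨ρ, rfl⟩ := Valuation.exists_toCtx_eq k
    exact (key ρ ψ Finset.subset_union_right).2 (h ρ ((key ρ φ Finset.subset_union_left).1 hk))

theorem sequentValid_iff {X : Finset (Var S)} {φ ψ : Form S} (hφ : φ.FV ⊆ X) (hψ : ψ.FV ⊆ X) :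
    U.SequentValid X φ ψ hφ hψ ↔ U.Entails φ ψ := by
  refine (lift_impArrow_eq_top (U.form φ X hφ) (U.form ψ X hψ)).trans ?_
  constructor
  · intro h Z ρ hρ
    have := h (ρ.toCtx X)
    rw [toCtx_form, toCtx_form] at this
    exact this hρ
  · intro h Z k hk
    obtain ⟨ρ, rfl⟩ := Valuation.exists_toCtx_eq k
    rw [toCtx_form] at hk ⊢
    exact h ρ hk

namespace Entails

variable {A B D : Form S} {x : Var S}

theorem all_inst (t : Term S x.srt) : U.Entails (.all x A) (A.inst x t) := fun Z ρ h => by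
  have := Forces.all_iff.1 h (𝟙 Z) (termValue ρ t)
  rw [Valuation.restrict_id] at this
  exact Forces.inst_iff.2 this

theorem all_intro (hx : x ∉ B.FV) (h : U.Entails B A) : U.Entails B (.all x A) := fun Z ρ hB =>
  Forces.all_iff.2 fun W k b => h _ <| (hB.mono k).congr fun y hy =>
    (Function.update_of_ne (by rintro rfl; exact hx hy) _ _).symm

theorem inst_ex (t : Term S x.srt) : U.Entails (A.inst x t) (.ex x A) := fun _ _ h =>
  Forces.ex_intro _ (Forces.inst_iff.1 h)

theorem ex_elim (hx : x ∉ B.FV) (h : U.Entails A B) : U.Entails (.ex x A) B := fun _ _ hA =>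
  hA.ex_elim fun _ _ _ hA' => (h _ hA').congr fun _ hy =>
    Function.update_of_ne (by rintro rfl; exact hx hy) _ _

/-- Updating `x` to the witness for `B` does not affect `A`. In the preorder this entailment is the
inverse of the canonical arrow. -/
theorem frobenius (hx : x ∉ A.FV) : U.Entails (.and A (.ex x B)) (.ex x (.and A B)) :=
  fun _ _ h => by
    obtain ⟨hA, hB⟩ := Forces.and_iff.1 h
    refine hB.ex_elim fun W k b hB' => Forces.ex_intro b (Forces.and_iff.2 ⟨?_, hB'⟩)
    exact (hA.mono k).congr fun y hy =>
      (Function.update_of_ne (by rintro rfl; exact hx hy) _ _).symm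

theorem and_left : U.Entails (.and A B) A := fun _ _ h => (Forces.and_iff.1 h).1

theorem and_right : U.Entails (.and A B) B := fun _ _ h => (Forces.and_iff.1 h).2

theorem and_intro (hA : U.Entails D A) (hB : U.Entails D B) : U.Entails D (.and A B) :=
  fun _ ρ h => Forces.and_iff.2 ⟨hA ρ h, hB ρ h⟩

theorem or_left : U.Entails A (.or A B) := fun _ _ h => h.or_inl

theorem or_right : U.Entails B (.or A B) := fun _ _ h => h.or_inr

theorem or_elim (hA : U.Entails A D) (hB : U.Entails B D) : U.Entails (.or A B) D :=
  fun _ _ h => h.or_elim (fun _ _ => hA _) (fun _ _ => hB _)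

theorem imp_iff : U.Entails D (.imp A B) ↔ U.Entails (.and D A) B := by
  constructor
  · intro h Z ρ hDA
    obtain ⟨hD, hA⟩ := Forces.and_iff.1 hDA
    have := Forces.imp_iff.1 (h ρ hD) (𝟙 Z)
    rw [Valuation.restrict_id] at this
    exact this hA
  · intro h Z ρ hD
    exact Forces.imp_iff.2 fun W k hA => h _ (Forces.and_iff.2 ⟨hD.mono k, hA⟩)

end Entails

end Model

end

end ToposLD

/-! ### The logically distributive structure of `LD(U)` -/

namespace ToposLD

noncomputable section

namespace Model

variable {S : Signature.{u₁, u₂, u₃}} {E : Type u} [Category.{v} E] [CartesianMonoidalCategory E]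
  [HasFiniteLimits E] [HasFiniteColimits E] [MonoidalClosed E] [HasSubobjectClassifier E]
  {U : Model S E}

theorem LDObj.exists_eq_LDMap (a : U.LDObj) : ∃ φ : Form S, a = U.LDMap φ := by
  obtain ⟨X, f, φ, rfl, rfl⟩ := a
  exact ⟨φ, rfl⟩

theorem Entails.of_hom {φ ψ : Form S} (f : U.LDMap φ ⟶ U.LDMap ψ) : U.Entails φ ψ :=
  LDMap_le_iff.1 (leOfHom f)

/-- The arrow of `LD(U)` given by an entailment. -/
def Entails.hom {φ ψ : Form S} (h : U.Entails φ ψ) : U.LDMap φ ⟶ U.LDMap ψ :=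
  homOfLE (LDMap_le_iff.2 h)

variable (U) in
/-- In `LD(U)` the conjunction is a binary product. -/
def isLimitAnd (φ ψ : Form S) : IsLimit (BinaryFan.mk (P := U.LDMap (.and φ ψ))
    (Entails.hom (U := U) (φ := .and φ ψ) (ψ := φ) Entails.and_left) (Entails.hom Entails.and_right)) :=
  BinaryFan.isLimitMk (fun s => homOfLE (by
      obtain ⟨χ, hχ⟩ := s.pt.exists_eq_LDMap
      have h1 := leOfHom s.fst
      have h2 := leOfHom s.snd
      rw [hχ] at h1 h2 ⊢
      exact LDMap_le_iff.2 ((LDMap_le_iff.1 h1).and_intro (LDMap_le_iff.1 h2))))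
    (fun _ => Subsingleton.elim _ _) (fun _ => Subsingleton.elim _ _)
    (fun _ _ _ _ => Subsingleton.elim _ _)

variable (U) in
/-- In `LD(U)` the disjunction is a binary coproduct. -/
def isColimitOr (φ ψ : Form S) : IsColimit (BinaryCofan.mk (P := U.LDMap (.or φ ψ))
    (Entails.hom (U := U) (φ := φ) Entails.or_left) (Entails.hom Entails.or_right)) :=
  BinaryCofan.isColimitMk (fun s => homOfLE (by
      obtain ⟨χ, hχ⟩ := s.pt.exists_eq_LDMap
      have h1 := leOfHom s.inl
      have h2 := leOfHom s.inr
      rw [hχ] at h1 h2 ⊢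
      exact LDMap_le_iff.2 ((LDMap_le_iff.1 h1).or_elim (LDMap_le_iff.1 h2))))
    (fun _ => Subsingleton.elim _ _) (fun _ => Subsingleton.elim _ _)
    (fun _ _ _ _ => Subsingleton.elim _ _)

variable (U) in
/-- `N ⊤` is terminal in `LD(U)`. -/
def isTerminalTop : IsTerminal (U.LDMap .top) :=
  IsTerminal.ofUniqueHom (fun a => homOfLE (by
      obtain ⟨χ, rfl⟩ := a.exists_eq_LDMap
      exact LDMap_le_iff.2 fun _ _ _ => Forces.top))
    (fun _ _ => Subsingleton.elim _ _)

variable (U) in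
/-- `N ⊥` is initial in `LD(U)`. -/
def isInitialBot : IsInitial (U.LDMap .bot) :=
  IsInitial.ofUniqueHom (fun a => homOfLE (by
      obtain ⟨χ, rfl⟩ := a.exists_eq_LDMap
      exact LDMap_le_iff.2 fun _ _ h => h.bot_elim))
    (fun _ _ => Subsingleton.elim _ _)

variable (U) in
theorem hasFiniteProducts_LDObj : HasFiniteProducts U.LDObj := by
  have : HasTerminal U.LDObj := (isTerminalTop U).hasTerminal
  have : ∀ {a b : U.LDObj}, HasLimit (pair a b) := fun {a b} => by
    obtain ⟨φ, rfl⟩ := a.exists_eq_LDMap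
    obtain ⟨ψ, rfl⟩ := b.exists_eq_LDMap
    exact ⟨⟨⟨_, isLimitAnd U φ ψ⟩⟩⟩
  have := hasBinaryProducts_of_hasLimit_pair U.LDObj
  exact hasFiniteProducts_of_has_binary_and_terminal

variable (U) in
theorem hasFiniteCoproducts_LDObj : HasFiniteCoproducts U.LDObj := by
  have : HasInitial U.LDObj := (isInitialBot U).hasInitial
  have : ∀ {a b : U.LDObj}, HasColimit (pair a b) := fun {a b} => by
    obtain ⟨φ, rfl⟩ := a.exists_eq_LDMap
    obtain ⟨ψ, rfl⟩ := b.exists_eq_LDMap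
    exact ⟨⟨⟨_, isColimitOr U φ ψ⟩⟩⟩
  have := hasBinaryCoproducts_of_hasColimit_pair U.LDObj
  exact hasFiniteCoproducts_of_has_binary_and_initial

variable (U) in
/-- The comparison of a chosen product with the conjunction. -/
def prodIsoAnd [HasFiniteProducts U.LDObj] (φ ψ : Form S) :
    U.LDMap φ ⨯ U.LDMap ψ ≅ U.LDMap (.and φ ψ) :=
  (limit.isLimit _).conePointUniqueUpToIso (isLimitAnd U φ ψ)

variable (U) in
/-- The comparison of a chosen coproduct with the disjunction. -/
def coprodIsoOr [HasFiniteCoproducts U.LDObj] (φ ψ : Form S) :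
    U.LDMap φ ⨿ U.LDMap ψ ≅ U.LDMap (.or φ ψ) :=
  (colimit.isColimit _).coconePointUniqueUpToIso (isColimitOr U φ ψ)

variable (U) in
theorem exists_isExponential_imp [HasFiniteProducts U.LDObj] (φ ψ : Form S) :
    ∃ ev : U.LDMap (.imp φ ψ) ⨯ U.LDMap φ ⟶ U.LDMap ψ, IsExponential ev := by
  refine ⟨(prodIsoAnd U _ _).hom ≫ Entails.hom (Entails.imp_iff.1 fun _ _ h => h),
    fun a f => ?_⟩
  obtain ⟨χ, rfl⟩ := a.exists_eq_LDMap
  exact ⟨Entails.hom (Entails.imp_iff.2 (Entails.of_hom ((prodIsoAnd U _ _).inv ≫ f))),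
    Subsingleton.elim _ _, fun _ _ => Subsingleton.elim _ _⟩

variable (U) in
theorem isIso_distribArrow [HasFiniteProducts U.LDObj] [HasFiniteCoproducts U.LDObj]
    (a b c : U.LDObj) : IsIso (distribArrow a b c) := by
  obtain ⟨φ, rfl⟩ := a.exists_eq_LDMap
  obtain ⟨ψ, rfl⟩ := b.exists_eq_LDMap
  obtain ⟨χ, rfl⟩ := c.exists_eq_LDMap
  have h : U.Entails (.and φ (.or ψ χ)) (.or (.and φ ψ) (.and φ χ)) := by
    -- Distributivity comes from exponentials: `φ` is moved to the right so that disjunction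
    -- elimination applies to `ψ ∨ χ` alone.
    have hψ : U.Entails ψ (.imp φ (.or (.and φ ψ) (.and φ χ))) :=
      Entails.imp_iff.2 fun _ _ h => Forces.or_inl
        (Forces.and_iff.2 (Forces.and_iff.1 h).symm)
    have hχ : U.Entails χ (.imp φ (.or (.and φ ψ) (.and φ χ))) :=
      Entails.imp_iff.2 fun _ _ h => Forces.or_inr
        (Forces.and_iff.2 (Forces.and_iff.1 h).symm)
    exact fun _ ρ h => Entails.imp_iff.1 (hψ.or_elim hχ) ρ
      (Forces.and_iff.2 (Forces.and_iff.1 h).symm)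
  exact ⟨prod.map (𝟙 _) (coprodIsoOr U ψ χ).hom ≫ (prodIsoAnd U _ _).hom ≫ h.hom ≫
    (coprodIsoOr U _ _).inv ≫ coprod.map (prodIsoAnd U _ _).inv (prodIsoAnd U _ _).inv,
    Subsingleton.elim _ _, Subsingleton.elim _ _⟩

variable (U) in
/-- The legs of the universal cone with vertex `N (∀ x. A)`. -/
def allProj (x : Var S) (A : Form S) (t : Term S x.srt) :
    U.LDMap (.all x A) ⟶ U.LDMap (A.inst x t) := (Entails.all_inst t).hom

variable (U) in
/-- The legs of the universal cocone with vertex `N (∃ x. A)`. -/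
def exInj (x : Var S) (A : Form S) (t : Term S x.srt) :
    U.LDMap (A.inst x t) ⟶ U.LDMap (.ex x A) := (Entails.inst_ex t).hom

variable (U) in
/-- The cone with vertex `N (∀ x. A)` is terminal. -/
def isTerminalAll (x : Var S) (A : Form S) : IsTerminal
    (ForallCat.mk (.all x A) (Form.notMem_FV_all x A) (allProj U x A)) :=
  IsTerminal.ofUniqueHom
    (fun c => ⟨⟨⟨homOfLE (by
        obtain ⟨⟨c, B, hB, hc⟩⟩ := c
        -- Only the leg at the term `x` is needed, since `A[x/x] = A`.
        have h := leOfHom (c.π.app ⟨.var x⟩)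
        change c.pt ≤ U.LDMap (A.inst x (.var x)) at h
        change c.pt ≤ U.LDMap (.all x A)
        rw [hc, Form.inst_var_self] at h
        rw [hc]
        exact LDMap_le_iff.2 (Entails.all_intro hB (LDMap_le_iff.1 h))),
      -- The arrow is admitted in the category because its codomain has vertex `N (∀x.A)`.
      fun _ => Subsingleton.elim _ _⟩⟩, Or.inr rfl⟩)
    (fun _ _ => by
      apply InducedWideCategory.Hom.ext
      apply InducedCategory.Hom.ext
      apply ConeMorphism.ext
      exact Subsingleton.elim _ _)

variable (U) in
/-- The cocone with vertex `N (∃ x. A)` is initial. -/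
def isInitialEx (x : Var S) (A : Form S) : IsInitial
    (ExistsCat.mk (.ex x A) (Form.notMem_FV_ex x A) (exInj U x A)) :=
  IsInitial.ofUniqueHom
    (fun c => ⟨⟨⟨homOfLE (by
        obtain ⟨⟨c, B, hB, hc⟩⟩ := c
        have h := leOfHom (c.ι.app ⟨.var x⟩)
        change U.LDMap (A.inst x (.var x)) ≤ c.pt at h
        change U.LDMap (.ex x A) ≤ c.pt
        rw [hc, Form.inst_var_self] at h
        rw [hc]
        exact LDMap_le_iff.2 (Entails.ex_elim hB (LDMap_le_iff.1 h))),
      fun _ => Subsingleton.elim _ _⟩⟩, Or.inr rfl⟩)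
    (fun _ _ => by
      apply InducedWideCategory.Hom.ext
      apply InducedCategory.Hom.ext
      apply CoconeMorphism.ext
      exact Subsingleton.elim _ _)

variable (U) in
/-- `LD(U)` is a logically distributive category. -/
def logDistStructure : LogDistStructure U.LDMap where
  hasFiniteProducts := hasFiniteProducts_LDObj U
  hasFiniteCoproducts := hasFiniteCoproducts_LDObj U
  exponentiation a b := by
    obtain ⟨φ, rfl⟩ := a.exists_eq_LDMap
    obtain ⟨ψ, rfl⟩ := b.exists_eq_LDMap
    have := hasFiniteProducts_LDObj U
    exact ⟨_, exists_isExponential_imp U φ ψ⟩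
  distributive :=
    have := hasFiniteProducts_LDObj U
    haveI := hasFiniteCoproducts_LDObj U
    isIso_distribArrow U
  hasTerminal x A := (isTerminalAll U x A).hasTerminal
  hasInitial x A := (isInitialEx U x A).hasInitial
  map_bot := ⟨isInitialBot U⟩
  map_top := ⟨isTerminalTop U⟩
  andFst _ _ := Entails.hom Entails.and_left
  andSnd _ _ := Entails.hom Entails.and_right
  map_and := isLimitAnd U
  map_or φ ψ := ⟨_, _, ⟨isColimitOr U φ ψ⟩⟩
  map_imp :=
    have := hasFiniteProducts_LDObj U
    exists_isExponential_imp U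
  allπ := allProj U
  map_all := isTerminalAll U
  exι := exInj U
  map_ex := isInitialEx U
  frobenius _ _ _ hA := ⟨Entails.hom (Entails.frobenius hA), Subsingleton.elim (α := _ ⟶ _) _ _,
    Subsingleton.elim (α := _ ⟶ _) _ _⟩

end Model

end

end ToposLD

/-- For a model `U` of a first-order signature `S` in an elementary topos `E`, `LD(U)` (the category
of interpretations of formulae, with the map `N = U.LDMap`) is a logically distributive category;
its objects are exactly the `N φ`, there is at most one arrow between two objects, and an arrow
`N φ ⟶ N ψ` exists iff `U` validates `φ ⊃ ψ`; and a sequent is valid in `U` iff it is valid in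
`LD(U)`. -/
theorem proposition10p11 (S : Signature.{u₁, u₂, u₃})
    {E : Type u} [Category.{v} E] [CartesianMonoidalCategory E]
    [HasFiniteLimits E] [HasFiniteColimits E] [MonoidalClosed E] [HasSubobjectClassifier E]
    (U : Model S E) :
    IsLogicallyDistributive U.LDMap ∧
    (∀ a : U.LDObj, ∃ φ : Form S, a = U.LDMap φ) ∧
    (∀ a b : U.LDObj, Subsingleton (a ⟶ b)) ∧
    (∀ φ ψ : Form S, Nonempty (U.LDMap φ ⟶ U.LDMap ψ) ↔ U.Validates (.imp φ ψ)) ∧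
    (∀ (X : Finset (Var S)) (φ ψ : Form S) (hφ : φ.FV ⊆ X) (hψ : ψ.FV ⊆ X),
      U.SequentValid X φ ψ hφ hψ ↔ LDSequentValid U.LDMap φ ψ) := by
  refine ⟨⟨Model.logDistStructure U⟩, Model.LDObj.exists_eq_LDMap, fun _ _ => inferInstance,
    fun φ ψ => ?_, fun X φ ψ hφ hψ => ?_⟩
  -- Validating `φ ⊃ ψ` is by definition validity of the sequent over `FV(φ) ∪ FV(ψ)`.
  · exact Iff.trans ⟨fun ⟨f⟩ => Model.Entails.of_hom f, fun h => ⟨h.hom⟩⟩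
      (Model.sequentValid_iff (X := φ.FV ∪ ψ.FV) Finset.subset_union_left
        Finset.subset_union_right).symm
  · exact (Model.sequentValid_iff hφ hψ).trans
      ⟨fun h => ⟨h.hom⟩, fun ⟨f⟩ => Model.Entails.of_hom f⟩
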